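/- Let $G=(X,Y,A,B,\pi,V)$ be a two-player one-round game: $X,Y,A,B$ are finite sets, $\pi$ is a probability distribution on $X\times Y$, and $V:A\times B\times X\times Y\to[0,1]$. Put $G_{x,y}^{a,b}=\pi(x,y)V(a,b,x,y)\ge 0$. The entangled value of $G$ is $$\omega^*(G)=\sup\Big|\sum_{x,y,a,b}G_{x,y}^{a,b}\,\langle\psi|A_x^a\otimes B_y^b|\psi\rangle\Big|,$$ the supremum being over all $d\in\mathbb N$, all $\psi\in\mathbb C^d\otimes\mathbb C^d$ with $\|\psi\|\le 1$, and all positive semidefinite $A_x^a,B_y^b\in M_d=M_d(\mathbb C)$ with $\sum_aA_x^a=\sum_bB_y^b=\mathrm{Id}$ for all $x,y$. Operator space structures are given by norms on the spaces $M_d(V)$, $d\ge 1$, of $d\times d$ matrices over $V$. On $M_k$ use $M_d(M_k)=M_{dk}$ with the operator norm. For a linear map $T:V\to W$ let $\|T\|_{cb}=\sup_d\|T_d:M_d(V)\to M_d(W)\|$, where $T_d$ applies $T$ to each entry. The dual structure on $V^*$ is $\|\phi\|_{M_d(V^*)}=\|v\mapsto(\phi_{ij}(v))_{i,j}:V\to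 M_d\|_{cb}$. Let $\ell_\infty^A$ be $\mathbb C^A$ with $\|\sum_aT_a\otimes e_a\|_{M_d(\ell_\infty^A)}=\max_a\|T_a\|$, let $\ell_1^A=(\ell_\infty^A)^*$, let $\ell_\infty^X(\ell_1^A)$ be $\mathbb C^{X\times A}$ with $\|\sum_{x,a}T_x^a\otimes e_x\otimes e_a\|_{M_d(\ell_\infty^X(\ell_1^A))}=\max_x\|\sum_aT_x^a\otimes e_a\|_{M_d(\ell_1^A)}$, and let $\ell_1^X(\ell_\infty^A)=(\ell_\infty^X(\ell_1^A))^*$, duals being identified with coordinate spaces through $\langle r,s\rangle=\sum_i r_is_i$; similarly for $Y,B$. For operator spaces $V,W$ and $z\in V\otimes W$ let $$\|z\|_{V\otimes_{\min}W}=\sup\big\{\|(T\otimes S)(z)\|_{M_{d^2}}:\ d\in\mathbb N,\ T:V\to M_d,\ S:W\to M_d\ \text{linear},\ \|T\|_{cb},\|S\|_{cb}\le 1\big\}.$$ Then, with $\hat G=\sum_{x,y,a,b}G_{x,y}^{a,b}\,(e_x\otimes e_a)\otimes(e_y\otimes e_b)$, the value $\omega^*(G)$ is finite and $$\omega^*(G)=\|\hat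 G\|_{\ell_1^X(\ell_\infty^A)\otimes_{\min}\ell_1^Y(\ell_\infty^B)}.$$ -/

import Mathlib

noncomputable section

namespace NonlocalGame

open scoped ComplexOrder

/-! ### Matrix norms, completely bounded norms, duality, minimal tensor norm

All norms are recorded with values in `[0, ∞]`, so that every supremum below is meaningful. -/

/-- The operator norm of a complex square matrix acting on the Euclidean (Hilbert) space. -/
def opNorm {ι : Type*} [Fintype ι] [DecidableEq ι] (M : Matrix ι ι ℂ) : ENNReal :=
  ‖Matrix.toEuclideanCLM (𝕜 := ℂ) M‖ₑ

/-- A sequence of norms on the spaces `M_d(V)`, `d = 0, 1, 2, …`: the data of an operator space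
structure on `V`. The specific sequences used are constructed explicitly below. -/
abbrev MatrixNorms (V : Type*) : Type _ :=
  (d : ℕ) → Matrix (Fin d) (Fin d) V → ENNReal

/-- The natural operator space structure of `M_k`, through `M_d(M_k) = M_{dk}`. -/
def matrixOSS (k : ℕ) : MatrixNorms (Matrix (Fin k) (Fin k) ℂ) :=
  fun d v => opNorm (Matrix.comp (Fin d) (Fin d) (Fin k) (Fin k) ℂ v)

/-- The completely bounded norm `‖T‖_cb = sup_d ‖T_d‖`, where `T_d : M_d(V) → M_d(W)` applies `T`
to every entry. -/
def cbNorm {V W : Type*} [AddCommGroup V] [Module ℂ V] [AddCommGroup W] [Module ℂ W]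
    (E : MatrixNorms V) (F : MatrixNorms W) (T : V →ₗ[ℂ] W) : ENNReal :=
  ⨆ (d : ℕ) (v : Matrix (Fin d) (Fin d) V) (_ : E d v ≤ 1), F d (v.map T)

/-- The linear map `V → M_d`, `v ↦ (φ_{ij}(v))_{ij}`, associated to a matrix `φ ∈ M_d(V^*)`. -/
def evalMap {V : Type*} [AddCommGroup V] [Module ℂ V] {d : ℕ}
    (φ : Matrix (Fin d) (Fin d) (Module.Dual ℂ V)) : V →ₗ[ℂ] Matrix (Fin d) (Fin d) ℂ where
  toFun v := φ.map fun f => f v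
  map_add' v w := by ext i j; simp
  map_smul' c v := by ext i j; simp

/-- The dual operator space structure on `V^*`: the norm of `φ ∈ M_d(V^*)` is the completely
bounded norm of the associated map `V → M_d`. -/
def dualOSS {V : Type*} [AddCommGroup V] [Module ℂ V] (E : MatrixNorms V) :
    MatrixNorms (Module.Dual ℂ V) :=
  fun d φ => cbNorm E (matrixOSS d) (evalMap φ)

/-- The dual of an operator space structure on `ℂ^ι`, again placed on `ℂ^ι` through the usual
identification of `r` with the functional `s ↦ ∑ i, r i * s i`. -/
def coordDualOSS {ι : Type*} [Fintype ι] [DecidableEq ι] (E : MatrixNorms (ι → ℂ)) :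
    MatrixNorms (ι → ℂ) :=
  fun d v => dualOSS E d (v.map (dotProductEquiv ℂ ι))

/-- The identification `M_d ⊗ M_d = M_{d²}`, `a ⊗ b ↦` Kronecker product of `a` and `b`. -/
def kroneckerMap (d : ℕ) :
    TensorProduct ℂ (Matrix (Fin d) (Fin d) ℂ) (Matrix (Fin d) (Fin d) ℂ) →ₗ[ℂ]
      Matrix (Fin d × Fin d) (Fin d × Fin d) ℂ :=
  TensorProduct.lift (Matrix.kroneckerBilinear (R := ℂ) (α := ℂ))

/-- The minimal tensor norm of `z ∈ V ⊗ W`: the supremum of `‖(T ⊗ S)(z)‖` in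
`M_d ⊗ M_d = M_{d²}`, over all `d` and all complete contractions `T : V → M_d`,
`S : W → M_d`. -/
def minNorm {V W : Type*} [AddCommGroup V] [Module ℂ V] [AddCommGroup W] [Module ℂ W]
    (E : MatrixNorms V) (F : MatrixNorms W) (z : TensorProduct ℂ V W) : ENNReal :=
  ⨆ (d : ℕ) (T : V →ₗ[ℂ] Matrix (Fin d) (Fin d) ℂ) (S : W →ₗ[ℂ] Matrix (Fin d) (Fin d) ℂ)
    (_ : cbNorm E (matrixOSS d) T ≤ 1) (_ : cbNorm F (matrixOSS d) S ≤ 1),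
    opNorm (kroneckerMap d (TensorProduct.map T S z))

/-! ### The spaces `ℓ_∞^A`, `ℓ_1^A`, `ℓ_∞^X(ℓ_1^A)` and `ℓ_1^X(ℓ_∞^A)` -/

/-- `ℓ_∞^A` (embedded as diagonal matrices): `‖v‖_{M_d(ℓ_∞^A)} = sup_a ‖v_a‖_{M_d}`. -/
def linftyOSS (A : Type*) : MatrixNorms (A → ℂ) :=
  fun _ v => ⨆ a, opNorm (v.map fun r => r a)

/-- `ℓ_1^A`, the dual of `ℓ_∞^A`. -/
def loneOSS (A : Type*) [Fintype A] [DecidableEq A] : MatrixNorms (A → ℂ) :=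
  coordDualOSS (linftyOSS A)

/-- `ℓ_∞^X(ℓ_1^A)`: the supremum over `x` of the norms of the `x`-th components in
`M_d(ℓ_1^A)`. -/
def linftyLoneOSS (X A : Type*) [Fintype A] [DecidableEq A] : MatrixNorms (X × A → ℂ) :=
  fun d v => ⨆ x, loneOSS A d (v.map fun r a => r (x, a))

/-- `ℓ_1^X(ℓ_∞^A)`, the dual of `ℓ_∞^X(ℓ_1^A)`. -/
def loneLinftyOSS (X A : Type*) [Fintype X] [DecidableEq X] [Fintype A] [DecidableEq A] :
    MatrixNorms (X × A → ℂ) :=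
  coordDualOSS (linftyLoneOSS X A)

/-! ### Games, quantum correlations and the entangled value -/

/-- A two-player one-round game: a probability distribution `prob` on pairs of questions and a
payoff function with values in `[0, 1]`. -/
structure Game (X Y A B : Type*) [Fintype X] [Fintype Y] where
  prob : X → Y → ℝ
  prob_nonneg : ∀ x y, 0 ≤ prob x y
  prob_sum : ∑ x, ∑ y, prob x y = 1
  payoff : A → B → X → Y → ℝ
  payoff_nonneg : ∀ a b x y, 0 ≤ payoff a b x y
  payoff_le_one : ∀ a b x y, payoff a b x y ≤ 1

/-- The coefficients `G_{x,y}^{a,b} = π(x,y) V(a,b,x,y)` of a game. -/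
def Game.coeff {X Y A B : Type*} [Fintype X] [Fintype Y] (G : Game X Y A B)
    (x : X) (y : Y) (a : A) (b : B) : ℝ :=
  G.prob x y * G.payoff a b x y

/-- The families `P(a,b|x,y) = ⟨ψ| A_x^a ⊗ B_y^b |ψ⟩`, where `ψ` lies in the unit ball of
`ℂ^d ⊗ ℂ^d` for some `d`, and `(A_x^a)_a`, `(B_y^b)_b` are POVMs in `M_d` for all `x`, `y`. -/
def quantumCorrelations (X Y A B : Type*) [Fintype A] [Fintype B] :
    Set (X → Y → A → B → ℝ) :=
  {P | ∃ (d : ℕ) (ψ : EuclideanSpace ℂ (Fin d × Fin d))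
      (E : X → A → Matrix (Fin d) (Fin d) ℂ) (F : Y → B → Matrix (Fin d) (Fin d) ℂ),
      ‖ψ‖ ≤ 1 ∧
      (∀ x a, (E x a).PosSemidef) ∧ (∀ x, ∑ a, E x a = 1) ∧
      (∀ y b, (F y b).PosSemidef) ∧ (∀ y, ∑ b, F y b = 1) ∧
      ∀ x y a b, (P x y a b : ℂ) =
        inner ℂ ψ (Matrix.toEuclideanCLM (𝕜 := ℂ) (Matrix.kronecker (E x a) (F y b)) ψ)}

/-- The entangled value `ω^*(G)`: the supremum of `|∑ G_{x,y}^{a,b} P(a,b|x,y)|` over all quantum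
correlations `P`. -/
def Game.entangledValue {X Y A B : Type*} [Fintype X] [Fintype Y] [Fintype A] [Fintype B]
    (G : Game X Y A B) : ENNReal :=
  ⨆ P ∈ quantumCorrelations X Y A B,
    ENNReal.ofReal |∑ x, ∑ y, ∑ a, ∑ b, G.coeff x y a b * P x y a b|

/-- The tensor `Ĝ = ∑ G_{x,y}^{a,b} (e_x ⊗ e_a) ⊗ (e_y ⊗ e_b)`. -/
def Game.tensor {X Y A B : Type*} [Fintype X] [DecidableEq X] [Fintype Y] [DecidableEq Y]
    [Fintype A] [DecidableEq A] [Fintype B] [DecidableEq B] (G : Game X Y A B) :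
    TensorProduct ℂ (X × A → ℂ) (Y × B → ℂ) :=
  ∑ x, ∑ y, ∑ a, ∑ b, (G.coeff x y a b : ℂ) •
    TensorProduct.tmul ℂ (Pi.single (x, a) (1 : ℂ)) (Pi.single (y, b) (1 : ℂ))

end NonlocalGame

end

/-!
A pair of families of POVMs is a pair of complete contractions on `ℓ_1^X(ℓ_∞^A)` and `ℓ_1^Y(ℓ_∞^B)`
(`cbNorm_le_one_of_povm`), so that the value of a quantum strategy is a diagonal coefficient of some
`(T ⊗ S)(Ĝ)`, and the entangled value is at most the minimal tensor norm.

For the converse, let `T` be a complete contraction on `ℓ_1^X(ℓ_∞^A)` and let `T_x^a` be its values on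
the unit vectors. For each `x` the matrix `∑ₐ uₐ ⊗ T_x^a` is a contraction whenever all `uₐ` are
(`opNorm_sum_kronecker_le_one_of_cbNorm`). This forces the existence of two POVMs `(Eₐ)`, `(E'ₐ)` such
that all block matrices `[Eₐ T_x^a; (T_x^a)* E'ₐ]` are positive semidefinite
(`exists_povm_fromBlocks_posSemidef`). Indeed, such blocks are the same as a positive functional on
`A`-tuples of `2 × 2` block matrices with prescribed values on the tuples whose diagonal blocks do not
depend on `a`; on those tuples the prescribed functional is positive (`blockFunctional_nonneg`), and
the M. Riesz extension theorem extends it.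

Tensoring the blocks obtained for `T` and for `S` gives
`2 Re ⟨φ, (T_x^a ⊗ S_y^b) ψ⟩ ≤ ⟨φ, (E_x^a ⊗ F_y^b) φ⟩ + ⟨ψ, (E'_x^a ⊗ F'_y^b) ψ⟩`. The coefficients of a
game are nonnegative, so the same inequality holds after summation against them, and the right-hand
side becomes a sum of two values of quantum strategies. Finiteness holds because the entries of a
quantum correlation are nonnegative and add up to at most `1` for each pair of questions.
-/

noncomputable section

namespace NonlocalGame

open scoped ComplexOrder Matrix Kronecker MatrixOrder

/-! ### Contractions and positive block matrices -/

section

variable {ι κ : Type*} [Fintype ι] [DecidableEq ι] [Fintype κ] [DecidableEq κ]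

theorem inner_toEuclideanCLM (M : Matrix ι ι ℂ) (x y : EuclideanSpace ℂ ι) :
    inner ℂ x (Matrix.toEuclideanCLM (𝕜 := ℂ) M y) = star x.ofLp ⬝ᵥ (M *ᵥ y.ofLp) := by
  rw [EuclideanSpace.inner_eq_star_dotProduct, Matrix.ofLp_toEuclideanCLM, dotProduct_comm]

theorem norm_sq_eq_re_dotProduct {ι : Type*} [Fintype ι] (x : EuclideanSpace ℂ ι) :
    ‖x‖ ^ 2 = (star x.ofLp ⬝ᵥ x.ofLp).re := by
  rw [← inner_self_eq_norm_sq (𝕜 := ℂ), EuclideanSpace.inner_eq_star_dotProduct, dotProduct_comm]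
  rfl

theorem opNorm_le_of_re_form_le {M : Matrix ι ι ℂ} {c : ℝ} (hc : 0 ≤ c)
    (h : ∀ x y : ι → ℂ, (star x ⬝ᵥ x).re = 1 → (star y ⬝ᵥ y).re = 1 →
      (star x ⬝ᵥ (M *ᵥ y)).re ≤ c) :
    opNorm M ≤ ENNReal.ofReal c := by
  rw [opNorm, ← ofReal_norm]
  refine ENNReal.ofReal_le_ofReal (ContinuousLinearMap.opNorm_le_of_re_inner_le hc ?_)
  intro y x hy hx
  rw [← inner_conj_symm, RCLike.conj_re, inner_toEuclideanCLM]
  apply h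
  · rw [← norm_sq_eq_re_dotProduct, hx, one_pow]
  · rw [← norm_sq_eq_re_dotProduct, hy, one_pow]

theorem norm_inner_toEuclideanCLM_le (M : Matrix ι ι ℂ) (x : EuclideanSpace ℂ ι) (hx : ‖x‖ ≤ 1) :
    ENNReal.ofReal ‖inner ℂ x (Matrix.toEuclideanCLM (𝕜 := ℂ) M x)‖ ≤ opNorm M := by
  rw [opNorm, ← ofReal_norm]
  refine ENNReal.ofReal_le_ofReal ((norm_inner_le_norm _ _).trans ?_)
  have := (Matrix.toEuclideanCLM (𝕜 := ℂ) M).le_opNorm x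
  have h0 := norm_nonneg (Matrix.toEuclideanCLM (𝕜 := ℂ) M)
  nlinarith [norm_nonneg x, norm_nonneg (Matrix.toEuclideanCLM (𝕜 := ℂ) M x)]

/-- The bound of the sesquilinear form of a contraction, with the product of the norms of the two
vectors replaced by their mean square. -/
theorem two_mul_re_form_le {M : Matrix ι ι ℂ} (hM : opNorm M ≤ 1) (x y : ι → ℂ) :
    2 * (star x ⬝ᵥ (M *ᵥ y)).re ≤ (star x ⬝ᵥ x).re + (star y ⬝ᵥ y).re := by
  have hM' : ‖Matrix.toEuclideanCLM (𝕜 := ℂ) M‖ ≤ 1 := by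
    rwa [opNorm, ← ofReal_norm, ← ENNReal.ofReal_one,
      ENNReal.ofReal_le_ofReal_iff zero_le_one] at hM
  have h1 := norm_sq_eq_re_dotProduct (WithLp.toLp 2 x)
  have h2 := norm_sq_eq_re_dotProduct (WithLp.toLp 2 y)
  have h3 := inner_toEuclideanCLM M (WithLp.toLp 2 x) (WithLp.toLp 2 y)
  simp only at h1 h2 h3
  rw [← h1, ← h2, ← h3]
  have h4 := re_inner_le_norm (𝕜 := ℂ) (WithLp.toLp 2 x)
    (Matrix.toEuclideanCLM (𝕜 := ℂ) M (WithLp.toLp 2 y))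
  have h5 := (Matrix.toEuclideanCLM (𝕜 := ℂ) M).le_of_opNorm_le hM' (WithLp.toLp 2 y)
  simp only [RCLike.re_to_complex] at h4
  nlinarith [norm_nonneg (WithLp.toLp 2 x), sq_nonneg (‖WithLp.toLp 2 x‖ - ‖WithLp.toLp 2 y‖)]

theorem re_form_conjTranspose {ι : Type*} [Fintype ι] (M : Matrix ι ι ℂ) (x y : ι → ℂ) :
    (star y ⬝ᵥ (Mᴴ *ᵥ x)).re = (star x ⬝ᵥ (M *ᵥ y)).re := by
  rw [← Complex.conj_re (star x ⬝ᵥ (M *ᵥ y))]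
  congr 1
  change _ = star _
  rw [Matrix.star_dotProduct, Matrix.star_mulVec, Matrix.conjTranspose_conjTranspose,
    Matrix.dotProduct_mulVec]

theorem re_form_fromBlocks {ι : Type*} [Fintype ι] (E M F : Matrix ι ι ℂ) (x y : ι → ℂ) :
    (star (Sum.elim x y) ⬝ᵥ (Matrix.fromBlocks E M Mᴴ F *ᵥ Sum.elim x y)).re =
      (star x ⬝ᵥ (E *ᵥ x)).re + 2 * (star x ⬝ᵥ (M *ᵥ y)).re + (star y ⬝ᵥ (F *ᵥ y)).re := by
  have h2 : star (Sum.elim x y) = Sum.elim (star x) (star y) := by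
    ext i; cases i <;> simp
  rw [Matrix.fromBlocks_mulVec, h2, sumElim_dotProduct_sumElim]
  simp only [Sum.elim_comp_inl, Sum.elim_comp_inr, dotProduct_add, Complex.add_re,
    re_form_conjTranspose]
  ring

/-- For a positive semidefinite block matrix with diagonal blocks `E`, `F`, the form given by the
off-diagonal block is dominated by the forms of the diagonal blocks. -/
theorem two_mul_re_form_le_of_fromBlocks {ι : Type*} [Fintype ι] {E M F : Matrix ι ι ℂ}
    (h : (Matrix.fromBlocks E M Mᴴ F).PosSemidef) (x y : ι → ℂ) :
    2 * (star x ⬝ᵥ (M *ᵥ y)).re ≤ (star x ⬝ᵥ (E *ᵥ x)).re + (star y ⬝ᵥ (F *ᵥ y)).re := by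
  have h1 := h.re_dotProduct_nonneg (Sum.elim x (-y))
  rw [RCLike.re_to_complex, re_form_fromBlocks] at h1
  simp only [Matrix.mulVec_neg, dotProduct_neg, star_neg, neg_dotProduct, neg_neg,
    Complex.neg_re] at h1
  linarith

/-- Contractivity as positivity of a block matrix; in this form it passes to tensor products and
sums. -/
theorem opNorm_le_one_iff_fromBlocks {M : Matrix ι ι ℂ} :
    opNorm M ≤ 1 ↔ (Matrix.fromBlocks 1 M Mᴴ 1).PosSemidef := by
  constructor
  · intro h
    have herm : (Matrix.fromBlocks 1 M Mᴴ 1).IsHermitian :=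
      Matrix.IsHermitian.fromBlocks Matrix.isHermitian_one rfl Matrix.isHermitian_one
    refine .of_dotProduct_mulVec_nonneg herm fun z => ?_
    rw [Complex.nonneg_iff]
    refine ⟨?_, (herm.im_star_dotProduct_mulVec_self z).symm⟩
    have := two_mul_re_form_le h (z ∘ Sum.inl) (-(z ∘ Sum.inr))
    rw [← Sum.elim_comp_inl_inr z, re_form_fromBlocks]
    simp only [Matrix.mulVec_neg, dotProduct_neg, star_neg, neg_dotProduct, neg_neg,
      Complex.neg_re, Matrix.one_mulVec] at this ⊢
    linarith
  · intro h
    rw [← ENNReal.ofReal_one]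
    refine opNorm_le_of_re_form_le zero_le_one fun x y hx hy => ?_
    have := two_mul_re_form_le_of_fromBlocks h x y
    simp only [Matrix.one_mulVec] at this
    linarith

theorem opNorm_submatrix_equiv_le_one_iff (M : Matrix ι ι ℂ) (e : κ ≃ ι) :
    opNorm (M.submatrix e e) ≤ 1 ↔ opNorm M ≤ 1 := by
  rw [opNorm_le_one_iff_fromBlocks, opNorm_le_one_iff_fromBlocks,
    ← Matrix.posSemidef_submatrix_equiv (Equiv.sumCongr e e)]
  congr!
  ext (i | i) (j | j) <;> simp [Matrix.one_apply]

end

/-! ### Complete contractions in coordinates -/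

theorem opNorm_sum_kronecker_comm {ι κ A : Type*} [Fintype ι] [DecidableEq ι] [Fintype κ]
    [DecidableEq κ] [Fintype A] (u : A → Matrix κ κ ℂ) (v : A → Matrix ι ι ℂ) :
    opNorm (∑ a, u a ⊗ₖ v a) ≤ 1 ↔ opNorm (∑ a, v a ⊗ₖ u a) ≤ 1 := by
  rw [← opNorm_submatrix_equiv_le_one_iff _ (Equiv.prodComm ι κ)]
  congr!
  ext i j
  simp [Matrix.sum_apply, mul_comm]

theorem map_eq_sum_smul_single {ι V : Type*} [Fintype ι] [DecidableEq ι] [AddCommGroup V]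
    [Module ℂ V] (T : (ι → ℂ) →ₗ[ℂ] V) (r : ι → ℂ) : T r = ∑ i, r i • T (Pi.single i 1) := by
  rw [LinearMap.pi_apply_eq_sum_univ T r]
  congr! with i _ j
  simp [Pi.single_apply, eq_comm]

/-- The complete contractions `ℂ^ι → M_d` in coordinates: the amplification of `T` sends
`∑ vᵢ ⊗ eᵢ` to `∑ vᵢ ⊗ T eᵢ`. -/
theorem cbNorm_le_one_iff {ι : Type*} [Fintype ι] [DecidableEq ι] (E : MatrixNorms (ι → ℂ))
    {d : ℕ} (T : (ι → ℂ) →ₗ[ℂ] Matrix (Fin d) (Fin d) ℂ) :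
    cbNorm E (matrixOSS d) T ≤ 1 ↔ ∀ (k : ℕ) (v : Matrix (Fin k) (Fin k) (ι → ℂ)), E k v ≤ 1 →
      opNorm (∑ i, v.map (fun r => r i) ⊗ₖ T (Pi.single i 1)) ≤ 1 := by
  simp only [cbNorm, iSup_le_iff, matrixOSS]
  congr!
  ext ⟨i, p⟩ ⟨j, q⟩
  rw [Matrix.comp_apply, Matrix.map_apply, map_eq_sum_smul_single]
  simp [Matrix.sum_apply]

theorem coordDualOSS_le_one_iff {ι : Type*} [Fintype ι] [DecidableEq ι]
    (E : MatrixNorms (ι → ℂ)) {d : ℕ} (v : Matrix (Fin d) (Fin d) (ι → ℂ)) :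
    coordDualOSS E d v ≤ 1 ↔ ∀ (k : ℕ) (w : Matrix (Fin k) (Fin k) (ι → ℂ)), E k w ≤ 1 →
      opNorm (∑ i, w.map (fun r => r i) ⊗ₖ v.map (fun r => r i)) ≤ 1 := by
  rw [coordDualOSS, dualOSS, cbNorm_le_one_iff]
  congr!
  ext i j
  simp [evalMap]

theorem loneOSS_le_one_iff {A : Type*} [Fintype A] [DecidableEq A] {d : ℕ}
    (v : Matrix (Fin d) (Fin d) (A → ℂ)) :
    loneOSS A d v ≤ 1 ↔ ∀ (k : ℕ) (u : A → Matrix (Fin k) (Fin k) ℂ), (∀ a, opNorm (u a) ≤ 1) →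
      opNorm (∑ a, u a ⊗ₖ v.map (fun r => r a)) ≤ 1 := by
  rw [loneOSS, coordDualOSS_le_one_iff]
  simp only [linftyOSS, iSup_le_iff]
  constructor
  · intro h k u hu
    exact h k (Matrix.of fun i j a => u a i j) hu
  · intro h k w hw
    exact h k (fun a => w.map fun r => r a) hw

/-- A complete contraction on `ℓ_1^X(ℓ_∞^A)` restricts to a complete contraction on each summand
`ℓ_∞^A`. The inclusion of the summand is completely contractive because the norm of `ℓ_1^A` is
defined by pairing with the unit balls of the `M_k(ℓ_∞^A)`, to which `u` belongs. -/
theorem opNorm_sum_kronecker_le_one_of_cbNorm {X A : Type*} [Fintype X] [DecidableEq X] [Fintype A]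
    [DecidableEq A] {d : ℕ} {T : (X × A → ℂ) →ₗ[ℂ] Matrix (Fin d) (Fin d) ℂ}
    (hT : cbNorm (loneLinftyOSS X A) (matrixOSS d) T ≤ 1) (x : X) {k : ℕ}
    (u : A → Matrix (Fin k) (Fin k) ℂ) (hu : ∀ a, opNorm (u a) ≤ 1) :
    opNorm (∑ a, u a ⊗ₖ T (Pi.single (x, a) 1)) ≤ 1 := by
  -- `T` is tested on `u`, placed in the summand with index `x`.
  have key := (cbNorm_le_one_iff _ T).1 hT k
    (Matrix.of fun i j (z : X × A) => if z.1 = x then u z.2 i j else 0) ?_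
  · convert key using 2
    rw [Fintype.sum_prod_type, Finset.sum_eq_single x]
    · refine Finset.sum_congr rfl fun a _ => ?_
      congr 1
      ext i j
      simp
    · intro x' _ hx'
      refine Finset.sum_eq_zero fun a _ => ?_
      ext i j
      simp [hx']
    · simp
  · rw [loneLinftyOSS, coordDualOSS_le_one_iff]
    intro m w hw
    have hw' := (loneOSS_le_one_iff _).1 (iSup_le_iff.1 hw x) k u hu
    rw [opNorm_sum_kronecker_comm] at hw'
    convert hw' using 2
    rw [Fintype.sum_prod_type, Finset.sum_eq_single x]
    · refine Finset.sum_congr rfl fun a _ => ?_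
      congr 1
      ext i j
      simp
    · intro x' _ hx'
      refine Finset.sum_eq_zero fun a _ => ?_
      ext i j
      simp [hx']
    · simp

/-- A POVM defines a complete contraction on `ℓ_∞^A`: the block matrices `[1 uₐ; uₐ* 1] ⊗ Eₐ` are
positive, and they add up to `[1 ∑ uₐ ⊗ Eₐ; * 1]`. -/
theorem opNorm_sum_kronecker_le_one_of_posSemidef {ι κ A : Type*} [Fintype ι] [DecidableEq ι]
    [Fintype κ] [DecidableEq κ] [Fintype A] {E : A → Matrix ι ι ℂ} (hE : ∀ a, (E a).PosSemidef)
    (hsum : ∑ a, E a = 1) (u : A → Matrix κ κ ℂ) (hu : ∀ a, opNorm (u a) ≤ 1) :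
    opNorm (∑ a, u a ⊗ₖ E a) ≤ 1 := by
  rw [opNorm_le_one_iff_fromBlocks]
  have h1 := (Matrix.posSemidef_sum Finset.univ fun a _ =>
    (opNorm_le_one_iff_fromBlocks.1 (hu a)).kronecker (hE a)).submatrix
      (Equiv.sumProdDistrib κ κ ι).symm
  have hs (p q : ι) : ∑ a, E a p q = (1 : Matrix ι ι ℂ) p q := by rw [← hsum, Matrix.sum_apply]
  refine (congrArg Matrix.PosSemidef (?_ : _ = _)).mpr h1
  refine Matrix.ext fun z w => ?_
  obtain ⟨i, p⟩ | ⟨i, p⟩ := z <;> obtain ⟨j, q⟩ | ⟨j, q⟩ := w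
  · simp [Matrix.sum_apply, hs, Matrix.one_apply, ite_and]
  · simp [Matrix.sum_apply]
  · have hh (a : A) : star (E a q p) = E a p q := (hE a).isHermitian.apply p q
    simp [Matrix.sum_apply, Matrix.conjTranspose_apply] at hh ⊢
    simp [hh]
  · simp [Matrix.sum_apply, hs, Matrix.one_apply, ite_and]

/-- POVMs `(E_x^a)_a`, `x ∈ X`, define a complete contraction on `ℓ_1^X(ℓ_∞^A)`: they form an element
of the unit ball of `M_d(ℓ_∞^X(ℓ_1^A))`, against which the norm of `ℓ_1^X(ℓ_∞^A)` is tested. -/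
theorem cbNorm_le_one_of_povm {X A : Type*} [Fintype X] [DecidableEq X] [Fintype A]
    [DecidableEq A] {d : ℕ} {T : (X × A → ℂ) →ₗ[ℂ] Matrix (Fin d) (Fin d) ℂ}
    (hpos : ∀ x a, (T (Pi.single (x, a) 1)).PosSemidef)
    (hsum : ∀ x, ∑ a, T (Pi.single (x, a) 1) = 1) :
    cbNorm (loneLinftyOSS X A) (matrixOSS d) T ≤ 1 := by
  rw [cbNorm_le_one_iff]
  intro k v hv
  rw [loneLinftyOSS, coordDualOSS_le_one_iff] at hv
  rw [opNorm_sum_kronecker_comm]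
  refine hv d (Matrix.of fun p q z => T (Pi.single z 1) p q) (iSup_le fun x => ?_)
  rw [loneOSS_le_one_iff]
  intro n u hu
  exact opNorm_sum_kronecker_le_one_of_posSemidef (hpos x) (hsum x) u hu

/-! ### Positive functionals on tuples of matrices -/

theorem exists_isUnit_eq_mul_conjTranspose {ι : Type*} [Fintype ι] [DecidableEq ι]
    {R : Matrix ι ι ℂ} (hR : R.PosDef) : ∃ C : Matrix ι ι ℂ, IsUnit C ∧ R = C * Cᴴ := by
  obtain ⟨C, hC⟩ := CStarAlgebra.nonneg_iff_eq_star_mul_self.mp hR.posSemidef.nonneg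
  have hu := hR.isUnit
  rw [hC] at hu
  refine ⟨star C, isUnit_of_mul_isUnit_left hu, ?_⟩
  rw [hC, Matrix.star_eq_conjTranspose, Matrix.conjTranspose_conjTranspose]

/-- Nonnegativity of `blockFunctional` on positive block matrices `[R Zₐ; Zₐ* S]` with `R`, `S`
positive definite. With `R = C C*` and `S = D D*`, the matrices `uₐ = C⁻¹ Zₐ (D*)⁻¹` are contractions,
and `∑ tr (Tₐ Zₐᵗ)` is the value of the form of `∑ uₐ ⊗ Tₐ` at the vectorizations of the entrywise
conjugates of `C` and `D`. -/
theorem neg_two_mul_re_trace_le_of_posDef {ι A : Type*} [Fintype ι] [DecidableEq ι] [Fintype A]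
    {T : A → Matrix ι ι ℂ}
    (hT : ∀ u : A → Matrix ι ι ℂ, (∀ a, opNorm (u a) ≤ 1) → opNorm (∑ a, u a ⊗ₖ T a) ≤ 1)
    {R S : Matrix ι ι ℂ} {Z : A → Matrix ι ι ℂ} (hR : R.PosDef) (hS : S.PosDef)
    (hZ : ∀ a, (Matrix.fromBlocks R (Z a) (Z a)ᴴ S).PosSemidef) :
    -(2 * ∑ a, (T a * (Z a)ᵀ).trace.re) ≤ R.trace.re + S.trace.re := by
  obtain ⟨C, hC, rfl⟩ := exists_isUnit_eq_mul_conjTranspose hR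
  obtain ⟨D, hD, rfl⟩ := exists_isUnit_eq_mul_conjTranspose hS
  rw [Matrix.isUnit_iff_isUnit_det] at hC hD
  have hC' : IsUnit Cᴴ.det := by rw [Matrix.det_conjTranspose]; exact hC.star
  have hD' : IsUnit Dᴴ.det := by rw [Matrix.det_conjTranspose]; exact hD.star
  have hu (a : A) : opNorm (C⁻¹ * Z a * Dᴴ⁻¹) ≤ 1 := by
    rw [opNorm_le_one_iff_fromBlocks]
    convert (hZ a).mul_mul_conjTranspose_same (Matrix.fromBlocks C⁻¹ 0 0 D⁻¹) using 1
    simp only [Matrix.fromBlocks_conjTranspose, Matrix.fromBlocks_multiply,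
      Matrix.conjTranspose_nonsing_inv, Matrix.conjTranspose_mul, Matrix.conjTranspose_zero,
      Matrix.zero_mul, Matrix.mul_zero, add_zero, zero_add, Matrix.conjTranspose_conjTranspose,
      Matrix.mul_assoc]
    rw [Matrix.mul_nonsing_inv _ hC', Matrix.mul_nonsing_inv _ hD', Matrix.mul_one, Matrix.mul_one,
      Matrix.nonsing_inv_mul _ hC, Matrix.nonsing_inv_mul _ hD]
  -- The sign of the first vector turns the upper bound into the lower bound that is wanted.
  have key := two_mul_re_form_le (hT _ hu) (-Matrix.vec (C.map star)) (Matrix.vec (D.map star))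
  have hconj (M : Matrix ι ι ℂ) : (M.map star)ᴴ = Mᵀ := by ext; simp
  have htr (M : Matrix ι ι ℂ) : ((M.map star)ᴴ * M.map star).trace = (M * Mᴴ).trace := by
    rw [hconj, Matrix.trace_mul_comm, ← Matrix.trace_transpose, Matrix.transpose_mul,
      Matrix.transpose_transpose]
    rfl
  have hpair (a : A) : ((C.map star)ᴴ * (T a * D.map star * (C⁻¹ * Z a * Dᴴ⁻¹)ᵀ)).trace =
      (T a * (Z a)ᵀ).trace := by
    have h1 : Z a = C * (C⁻¹ * Z a * Dᴴ⁻¹) * Dᴴ := by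
      rw [Matrix.mul_assoc, Matrix.mul_assoc (C⁻¹ * Z a), Matrix.nonsing_inv_mul _ hD',
        Matrix.mul_one, ← Matrix.mul_assoc, Matrix.mul_nonsing_inv _ hC, Matrix.one_mul]
    conv_rhs => rw [h1]
    rw [hconj, Matrix.trace_mul_comm, Matrix.transpose_mul _ Dᴴ, Matrix.transpose_mul C]
    simp only [Matrix.mul_assoc]
    rfl
  simp only [star_neg, neg_dotProduct, dotProduct_neg, neg_neg, Matrix.star_vec_dotProduct_vec,
    Matrix.sum_mulVec, Matrix.kronecker_mulVec_vec, dotProduct_sum, htr, hpair, Complex.neg_re,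
    Complex.re_sum, Finset.sum_neg_distrib] at key
  linarith

/-- The case of positive semidefinite blocks `R`, `S`, by adding a small multiple of the identity. -/
theorem re_trace_add_nonneg {ι A : Type*} [Fintype ι] [DecidableEq ι] [Fintype A] [Nonempty A]
    {T : A → Matrix ι ι ℂ}
    (hT : ∀ u : A → Matrix ι ι ℂ, (∀ a, opNorm (u a) ≤ 1) → opNorm (∑ a, u a ⊗ₖ T a) ≤ 1)
    {R S : Matrix ι ι ℂ} {Z : A → Matrix ι ι ℂ}
    (hZ : ∀ a, (Matrix.fromBlocks R (Z a) (Z a)ᴴ S).PosSemidef) :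
    0 ≤ R.trace.re + S.trace.re + 2 * ∑ a, (T a * (Z a)ᵀ).trace.re := by
  obtain ⟨a₀⟩ := ‹Nonempty A›
  have hR : R.PosSemidef := (hZ a₀).submatrix Sum.inl
  have hS : S.PosSemidef := (hZ a₀).submatrix Sum.inr
  have key (ε : ℝ) (hε : 0 < ε) : 0 ≤ R.trace.re + S.trace.re +
      2 * ∑ a, (T a * (Z a)ᵀ).trace.re + ε * (2 * Fintype.card ι) := by
    have hε1 : ((ε : ℂ) • (1 : Matrix ι ι ℂ)).PosDef :=
      Matrix.PosDef.one.smul (by exact_mod_cast hε)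
    have h := neg_two_mul_re_trace_le_of_posDef hT (hε1.posSemidef_add hR)
      (hε1.posSemidef_add hS) (Z := Z) fun a => by
        convert (hZ a).add ((Matrix.PosDef.one (n := ι ⊕ ι) (R := ℂ)).smul
          (show (0 : ℂ) < ε by exact_mod_cast hε)).posSemidef using 1
        rw [← Matrix.fromBlocks_one, Matrix.fromBlocks_smul, Matrix.fromBlocks_add]
        simp
    simp [Matrix.trace_add, Matrix.trace_smul] at h
    linarith
  refine le_of_forall_pos_le_add fun δ hδ => ?_
  have hc : (0 : ℝ) < 2 * Fintype.card ι + 1 := by positivity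
  have := key (δ / (2 * Fintype.card ι + 1)) (by positivity)
  refine this.trans (add_le_add_right ?_ _)
  rw [div_mul_eq_mul_div, div_le_iff₀ hc]
  nlinarith

/-- A real-linear functional on tuples of complex matrices that is nonnegative on the tuples with
positive semidefinite Hermitian part is given by positive semidefinite matrices. -/
theorem exists_posSemidef_of_nonneg {ι A : Type*} [Fintype ι] [DecidableEq ι] [Fintype A]
    [DecidableEq A] (g : (A → Matrix ι ι ℂ) →ₗ[ℝ] ℝ)
    (hg : ∀ Q : A → Matrix ι ι ℂ, (∀ a, (Q a + (Q a)ᴴ).PosSemidef) → 0 ≤ g Q) :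
    ∃ P : A → Matrix ι ι ℂ, (∀ a, (P a).PosSemidef) ∧
      ∀ Q, g Q = ∑ a, (P a * (Q a)ᵀ).trace.re := by
  -- `P a` is read off from `g` at the matrix units, so that `g` pairs `Q a` with `P a` without
  -- conjugation.
  let e (a : A) (i j : ι) (z : ℂ) : ℝ := g (Pi.single a (Matrix.single i j z))
  let P (a : A) : Matrix ι ι ℂ := Matrix.of fun i j => ⟨e a i j 1, -e a i j Complex.I⟩
  have he (a : A) (i j : ι) (z : ℂ) : e a i j z = (P a i j * z).re := by
    have hz : (Pi.single a (Matrix.single i j z) : A → Matrix ι ι ℂ) =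
        z.re • (Pi.single a (Matrix.single i j 1) : A → Matrix ι ι ℂ) +
          z.im • (Pi.single a (Matrix.single i j Complex.I) : A → Matrix ι ι ℂ) := by
      rw [← Pi.single_smul, ← Pi.single_smul, ← Pi.single_add, Matrix.smul_single,
        Matrix.smul_single, ← Matrix.single_add]
      congr 2
      apply Complex.ext <;> simp
    simp only [e, P, hz, map_add, map_smul, Matrix.of_apply, Complex.mul_re, smul_eq_mul]
    ring
  have hgQ (Q : A → Matrix ι ι ℂ) : g Q = ∑ a, (P a * (Q a)ᵀ).trace.re := by
    have hQ : Q = ∑ a, ∑ i, ∑ j, Pi.single a (Matrix.single i j (Q a i j)) := by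
      conv_lhs => rw [← Finset.univ_sum_single Q]
      refine Finset.sum_congr rfl fun a _ => ?_
      have h : Pi.single a (Q a) = LinearMap.single ℝ (fun _ : A => Matrix ι ι ℂ) a
          (∑ i, ∑ j, Matrix.single i j (Q a i j)) := by
        rw [← Matrix.matrix_eq_sum_single]; rfl
      rw [h]
      simp only [map_sum]
      rfl
    conv_lhs => rw [hQ]
    simp only [map_sum, Matrix.trace, Matrix.diag, Matrix.mul_apply, Complex.re_sum,
      Matrix.transpose_apply]
    exact Finset.sum_congr rfl fun a _ => Finset.sum_congr rfl fun i _ =>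
      Finset.sum_congr rfl fun j _ => he a i j _
  -- An antihermitian tuple and its negative both have zero Hermitian part.
  have hanti (Q : A → Matrix ι ι ℂ) (hQ : ∀ a, Q a + (Q a)ᴴ = 0) : g Q = 0 := by
    refine le_antisymm ?_ (hg Q fun a => (hQ a).symm ▸ Matrix.PosSemidef.zero)
    have := hg (-Q) fun a => by
      have : (-Q) a + ((-Q) a)ᴴ = 0 := by
        rw [Pi.neg_apply, Matrix.conjTranspose_neg, ← neg_add, hQ, neg_zero]
      rw [this]; exact Matrix.PosSemidef.zero
    rw [map_neg] at this
    linarith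
  have hherm (a : A) : (P a).IsHermitian := by
    refine Matrix.IsHermitian.ext fun i j => ?_
    have h (z : ℂ) : (P a i j * z).re = (P a j i * star z).re := by
      rw [← he, ← he, ← sub_eq_zero]
      simp only [e, ← map_sub]
      refine hanti _ fun b => ?_
      obtain rfl | hb := eq_or_ne b a
      · simp
      · simp [hb]
    have h1 := h 1
    have h2 := h Complex.I
    simp at h1 h2
    apply Complex.ext
    · simp [h1]
    · simp [← h2]
  refine ⟨P, fun a => .of_dotProduct_mulVec_nonneg (hherm a) fun x => ?_, hgQ⟩
  rw [Complex.nonneg_iff]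
  refine ⟨?_, ((hherm a).im_star_dotProduct_mulVec_self x).symm⟩
  have h := hg (Pi.single a (Matrix.vecMulVec (star x) x)) fun b => by
    obtain rfl | hb := eq_or_ne b a
    · have := Matrix.posSemidef_vecMulVec_star_self x
      rw [Pi.single_eq_same]
      exact this.add this.conjTranspose
    · simp [hb, Matrix.PosSemidef.zero]
  rw [hgQ, Finset.sum_eq_single a (by intro b _ hb; simp [hb]) (by simp), Pi.single_eq_same,
    Matrix.transpose_vecMulVec, Matrix.mul_vecMulVec, Matrix.trace_vecMulVec,
    dotProduct_comm] at h
  exact h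

/-! ### Complete contractions as off-diagonal blocks of POVMs -/

theorem trace_mul_transpose_single {ι : Type*} [Fintype ι] [DecidableEq ι] (P : Matrix ι ι ℂ)
    (i j : ι) (z : ℂ) : (P * (Matrix.single i j z)ᵀ).trace = P i j * z := by
  rw [Matrix.transpose_single, Matrix.trace_mul_single]
  simp [mul_comm]

theorem complex_ext_of_re_mul {w w' : ℂ} (h : ∀ z : ℂ, (w * z).re = (w' * z).re) : w = w' := by
  have h1 := h 1
  have h2 := h Complex.I
  simp only [mul_one, Complex.mul_I_re, neg_inj] at h1 h2
  exact Complex.ext h1 h2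

/-- A complex matrix plus a large multiple of the identity has positive semidefinite Hermitian part. -/
theorem exists_posSemidef_smul_one_add {ι : Type*} [Fintype ι] [DecidableEq ι]
    (M : Matrix ι ι ℂ) : ∃ c : ℝ, ∀ c' : ℝ, c ≤ c' →
      (((c' : ℂ) • 1 + M) + ((c' : ℂ) • 1 + M)ᴴ).PosSemidef := by
  refine ⟨‖Matrix.toEuclideanCLM (𝕜 := ℂ) M‖, fun c' hc => ?_⟩
  have herm := Matrix.isHermitian_add_transpose_self ((c' : ℂ) • 1 + M)
  refine .of_dotProduct_mulVec_nonneg herm fun x => ?_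
  rw [Complex.nonneg_iff]
  refine ⟨?_, (herm.im_star_dotProduct_mulVec_self x).symm⟩
  rw [Matrix.add_mulVec, dotProduct_add, Complex.add_re, re_form_conjTranspose, Matrix.add_mulVec,
    dotProduct_add, Matrix.smul_mulVec, Matrix.one_mulVec, dotProduct_smul, smul_eq_mul,
    Complex.add_re, Complex.re_ofReal_mul]
  have h1 := norm_sq_eq_re_dotProduct (WithLp.toLp 2 x)
  have h3 := inner_toEuclideanCLM M (WithLp.toLp 2 x) (WithLp.toLp 2 x)
  have h4 := norm_inner_le_norm (𝕜 := ℂ) (WithLp.toLp 2 x)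
    (Matrix.toEuclideanCLM (𝕜 := ℂ) M (WithLp.toLp 2 x))
  have h5 := (Matrix.toEuclideanCLM (𝕜 := ℂ) M).le_of_opNorm_le hc (WithLp.toLp 2 x)
  simp only at h1 h3
  rw [h3] at h4
  have h6 := (abs_le.1 (Complex.abs_re_le_norm (star x ⬝ᵥ (M *ᵥ x)))).1
  rw [← h1]
  nlinarith [norm_nonneg (WithLp.toLp 2 x)]

/-- The cone of tuples of matrices with positive semidefinite Hermitian part. -/
def accretiveCone (ι A : Type*) : PointedCone ℝ (A → Matrix ι ι ℂ) where
  carrier := {Q | ∀ a, (Q a + (Q a)ᴴ).PosSemidef}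
  add_mem' {Q Q'} hQ hQ' a := by
    rw [Pi.add_apply, Matrix.conjTranspose_add, add_add_add_comm]
    exact (hQ a).add (hQ' a)
  zero_mem' a := by simp [Matrix.PosSemidef.zero]
  smul_mem' c Q hQ a := by
    have h : (c • Q) a + ((c • Q) a)ᴴ = ((c : ℝ) : ℂ) • (Q a + (Q a)ᴴ) := by
      ext i j
      change ((c : ℝ) : ℂ) * Q a i j + star (((c : ℝ) : ℂ) * Q a j i) = _
      simp [mul_add]
    rw [h]
    exact (hQ a).smul (by exact_mod_cast c.2)

/-- The tuples of `2 × 2` block matrices whose diagonal blocks do not depend on the index. -/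
def constDiagBlocks (ι : Type*) {A : Type*} (a₀ : A) :
    Submodule ℝ (A → Matrix (ι ⊕ ι) (ι ⊕ ι) ℂ) where
  carrier := {Q | ∀ a, (Q a).submatrix Sum.inl Sum.inl = (Q a₀).submatrix Sum.inl Sum.inl ∧
    (Q a).submatrix Sum.inr Sum.inr = (Q a₀).submatrix Sum.inr Sum.inr}
  add_mem' {Q Q'} hQ hQ' a := by
    simp only [Pi.add_apply, Matrix.submatrix_add, hQ a, hQ' a, and_self]
  zero_mem' a := by simp
  smul_mem' c Q hQ a := by
    simp only [Pi.smul_apply, Matrix.submatrix_smul, hQ a, and_self]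

/-- The functional `Q ↦ Re (tr R + tr S + ∑ₐ (tr Tₐ Zₐᵗ + tr Tₐ* Wₐᵗ))` for `Qₐ = [R Zₐ; Wₐ S]`; the
blocks `R` and `S` are read off at the index `a₀`. -/
def blockFunctional {ι A : Type*} [Fintype ι] [Fintype A] (T : A → Matrix ι ι ℂ) (a₀ : A) :
    (A → Matrix (ι ⊕ ι) (ι ⊕ ι) ℂ) →ₗ[ℝ] ℝ where
  toFun Q := ((Q a₀).submatrix Sum.inl Sum.inl).trace.re +
    ((Q a₀).submatrix Sum.inr Sum.inr).trace.re +
    ∑ a, ((T a * ((Q a).submatrix Sum.inl Sum.inr)ᵀ).trace.re +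
      ((T a)ᴴ * ((Q a).submatrix Sum.inr Sum.inl)ᵀ).trace.re)
  map_add' Q Q' := by
    simp only [Pi.add_apply, Matrix.submatrix_add, Matrix.trace_add, Complex.add_re,
      Matrix.transpose_add, Matrix.mul_add, Finset.sum_add_distrib]
    ring
  map_smul' c Q := by
    simp only [Pi.smul_apply, Matrix.submatrix_smul, Matrix.trace_smul, Complex.smul_re,
      Matrix.transpose_smul, Matrix.mul_smul, Finset.sum_add_distrib, ← Finset.smul_sum,
      ← smul_add, RingHom.id_apply]

/-- `blockFunctional` takes the same value at a tuple and at its adjoint, so that only the Hermitian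
part matters. -/
theorem blockFunctional_nonneg {ι A : Type*} [Fintype ι] [DecidableEq ι] [Fintype A]
    {T : A → Matrix ι ι ℂ}
    (hT : ∀ u : A → Matrix ι ι ℂ, (∀ a, opNorm (u a) ≤ 1) → opNorm (∑ a, u a ⊗ₖ T a) ≤ 1)
    (a₀ : A) {Q : A → Matrix (ι ⊕ ι) (ι ⊕ ι) ℂ} (hD : Q ∈ constDiagBlocks ι a₀)
    (hQ : Q ∈ accretiveCone (ι ⊕ ι) A) : 0 ≤ blockFunctional T a₀ Q := by
  have : Nonempty A := ⟨a₀⟩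
  let R := (Q a₀).submatrix Sum.inl Sum.inl
  let S := (Q a₀).submatrix Sum.inr Sum.inr
  let Z (a : A) := (Q a).submatrix Sum.inl Sum.inr
  let W (a : A) := (Q a).submatrix Sum.inr Sum.inl
  have h := re_trace_add_nonneg hT (R := R + Rᴴ) (S := S + Sᴴ) (Z := fun a => Z a + (W a)ᴴ)
    fun a => by
      refine (congrArg Matrix.PosSemidef (?_ : _ = _)).mpr (hQ a)
      have h1 : (Q a).submatrix Sum.inl Sum.inl = R := (hD a).1
      have h2 : (Q a).submatrix Sum.inr Sum.inr = S := (hD a).2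
      rw [← h1, ← h2]
      refine Matrix.ext fun i j => ?_
      rcases i with i | i <;> rcases j with j | j <;> simp [Z, W, add_comm]
  have hc (M : Matrix ι ι ℂ) : Mᴴ.trace.re = M.trace.re := by
    rw [Matrix.trace_conjTranspose, ← starRingEnd_apply, Complex.conj_re]
  have hW (a : A) : (T a * (W a)ᴴᵀ).trace.re = ((T a)ᴴ * (W a)ᵀ).trace.re := by
    rw [← hc, Matrix.conjTranspose_mul, Matrix.trace_mul_comm]
    congr 4
    ext; simp
  simp only [Matrix.trace_add, Complex.add_re, hc, Matrix.transpose_add, Matrix.mul_add, hW] at h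
  change 0 ≤ R.trace.re + S.trace.re +
    ∑ a, ((T a * (Z a)ᵀ).trace.re + ((T a)ᴴ * (W a)ᵀ).trace.re)
  linarith

/-- A form of the Wittstock decomposition for maps `ℓ_∞^A → M_d`:
if `∑ uₐ ⊗ Tₐ` is a contraction for all contractions `uₐ`, then the `Tₐ` are off-diagonal
blocks of positive semidefinite matrices whose diagonal blocks form two POVMs. The blocks
represent a positive functional that extends `blockFunctional`. -/
theorem exists_povm_fromBlocks_posSemidef {ι A : Type*} [Fintype ι] [DecidableEq ι] [Fintype A]
    [Nonempty A] {T : A → Matrix ι ι ℂ}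
    (hT : ∀ u : A → Matrix ι ι ℂ, (∀ a, opNorm (u a) ≤ 1) → opNorm (∑ a, u a ⊗ₖ T a) ≤ 1) :
    ∃ E F : A → Matrix ι ι ℂ, (∀ a, (Matrix.fromBlocks (E a) (T a) (T a)ᴴ (F a)).PosSemidef) ∧
      ∑ a, E a = 1 ∧ ∑ a, F a = 1 := by
  classical
  obtain ⟨a₀⟩ := ‹Nonempty A›
  obtain ⟨g, hgf, hg⟩ := riesz_extension (accretiveCone (ι ⊕ ι) A)
    ⟨constDiagBlocks ι a₀, (blockFunctional T a₀).domRestrict (constDiagBlocks ι a₀)⟩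
    (fun Q hQ => blockFunctional_nonneg hT a₀ Q.2 hQ) (fun Q => by
      choose c hc using fun a => exists_posSemidef_smul_one_add (Q a)
      obtain ⟨M, hM⟩ := (Set.finite_range c).bddAbove
      exact ⟨⟨fun _ => (M : ℂ) • 1, fun _ => ⟨rfl, rfl⟩⟩, fun a => hc a M (hM ⟨a, rfl⟩)⟩)
  obtain ⟨P, hP, hgP⟩ := exists_posSemidef_of_nonneg g hg
  -- The values of the representing matrices on the domain of the original functional.
  have hpair (R S : Matrix ι ι ℂ) (Z : A → Matrix ι ι ℂ) :
      ∑ a, (((P a).toBlocks₁₁ * Rᵀ).trace.re + ((P a).toBlocks₁₂ * (Z a)ᵀ).trace.re +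
        ((P a).toBlocks₂₂ * Sᵀ).trace.re) =
      R.trace.re + S.trace.re + ∑ a, (T a * (Z a)ᵀ).trace.re := by
    have h1 : g (fun a => Matrix.fromBlocks R (Z a) 0 S) =
        blockFunctional T a₀ (fun a => Matrix.fromBlocks R (Z a) 0 S) :=
      hgf ⟨fun a => Matrix.fromBlocks R (Z a) 0 S, fun _ => ⟨rfl, rfl⟩⟩
    have h2 : blockFunctional T a₀ (fun a => Matrix.fromBlocks R (Z a) 0 S) =
        R.trace.re + S.trace.re +
          ∑ a, ((T a * (Z a)ᵀ).trace.re + ((T a)ᴴ * (0 : Matrix ι ι ℂ)ᵀ).trace.re) := rfl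
    rw [hgP, h2] at h1
    simp only [Matrix.transpose_zero, Matrix.mul_zero, Matrix.trace_zero, Complex.zero_re,
      add_zero] at h1
    rw [← h1]
    refine Finset.sum_congr rfl fun a _ => ?_
    conv_rhs => rw [← Matrix.fromBlocks_toBlocks (P a), Matrix.fromBlocks_transpose,
      Matrix.fromBlocks_multiply]
    simp only [Matrix.trace, Matrix.diag, Fintype.sum_sum_type, Matrix.fromBlocks_apply₁₁,
      Matrix.fromBlocks_apply₂₂, Matrix.transpose_zero, Matrix.mul_zero, zero_add,
      Matrix.add_apply, Finset.sum_add_distrib, Complex.add_re]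
  have hoff (a : A) : (P a).toBlocks₁₂ = T a := by
    refine Matrix.ext fun p q => complex_ext_of_re_mul fun z => ?_
    have h := hpair 0 0 (Pi.single a (Matrix.single p q z))
    simp only [Matrix.transpose_zero, Matrix.mul_zero, Matrix.trace_zero, Complex.zero_re,
      add_zero, zero_add] at h
    rwa [Finset.sum_eq_single a (by intro b _ hb; simp [hb]) (by simp),
      Finset.sum_eq_single a (by intro b _ hb; simp [hb]) (by simp), Pi.single_eq_same,
      trace_mul_transpose_single, trace_mul_transpose_single] at h
  have htr (p q : ι) (z : ℂ) : (Matrix.single p q z).trace = (1 : Matrix ι ι ℂ) p q * z := by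
    rw [← trace_mul_transpose_single, Matrix.one_mul, Matrix.trace_transpose]
  refine ⟨fun a => (P a).toBlocks₁₁, fun a => (P a).toBlocks₂₂, fun a => ?_, ?_, ?_⟩
  · have h21 : (T a)ᴴ = (P a).toBlocks₂₁ := by
      rw [← hoff]
      exact Matrix.ext fun i j => (hP a).isHermitian.apply _ _
    rw [h21, ← hoff, Matrix.fromBlocks_toBlocks]
    exact hP a
  · refine Matrix.ext fun p q => complex_ext_of_re_mul fun z => ?_
    have h := hpair (Matrix.single p q z) 0 0
    simp only [trace_mul_transpose_single, Pi.zero_apply, Matrix.transpose_zero, Matrix.mul_zero,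
      Matrix.trace_zero, Complex.zero_re, add_zero, Finset.sum_const_zero, htr] at h
    rw [Matrix.sum_apply, Finset.sum_mul, Complex.re_sum, h]
  · refine Matrix.ext fun p q => complex_ext_of_re_mul fun z => ?_
    have h := hpair 0 (Matrix.single p q z) 0
    simp only [trace_mul_transpose_single, Pi.zero_apply, Matrix.transpose_zero, Matrix.mul_zero,
      Matrix.trace_zero, Complex.zero_re, add_zero, zero_add, Finset.sum_const_zero, htr] at h
    rw [Matrix.sum_apply, Finset.sum_mul, Complex.re_sum, h]

/-! ### The entangled value and the minimal tensor norm -/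

section

variable {X Y A B : Type*} [Fintype X] [Fintype Y]

theorem two_mul_re_form_kronecker_le {ι κ : Type*} [Fintype ι] [Fintype κ]
    {E T E' : Matrix ι ι ℂ} {F S F' : Matrix κ κ ℂ}
    (h₁ : (Matrix.fromBlocks E T Tᴴ E').PosSemidef)
    (h₂ : (Matrix.fromBlocks F S Sᴴ F').PosSemidef) (x y : ι × κ → ℂ) :
    2 * (star x ⬝ᵥ ((T ⊗ₖ S) *ᵥ y)).re ≤
      (star x ⬝ᵥ ((E ⊗ₖ F) *ᵥ x)).re + (star y ⬝ᵥ ((E' ⊗ₖ F') *ᵥ y)).re := by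
  refine two_mul_re_form_le_of_fromBlocks ?_ x y
  have h := (h₁.kronecker h₂).submatrix
    (Sum.elim (Prod.map Sum.inl Sum.inl) (Prod.map Sum.inr Sum.inr) :
      (ι × κ) ⊕ (ι × κ) → (ι ⊕ ι) × (κ ⊕ κ))
  refine (congrArg Matrix.PosSemidef (Matrix.ext fun i j => ?_)).mpr h
  rcases i with i | i <;> rcases j with j | j <;> simp

theorem Game.coeff_nonneg (G : Game X Y A B) (x : X) (y : Y) (a : A) (b : B) :
    0 ≤ G.coeff x y a b :=
  mul_nonneg (G.prob_nonneg x y) (G.payoff_nonneg a b x y)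

theorem sum_sum_kronecker_eq_one {ι κ : Type*} [DecidableEq ι]
    [DecidableEq κ] [Fintype A] [Fintype B] {E : A → Matrix ι ι ℂ} {F : B → Matrix κ κ ℂ}
    (hE : ∑ a, E a = 1) (hF : ∑ b, F b = 1) : ∑ a, ∑ b, E a ⊗ₖ F b = 1 := by
  rw [← Matrix.one_kronecker_one, ← hE, ← hF]
  ext i j
  simp [Matrix.sum_apply, Finset.sum_mul_sum]

theorem Game.abs_sum_le_one (G : Game X Y A B) [Fintype A] [Fintype B] {P : X → Y → A → B → ℝ}
    (hP : P ∈ quantumCorrelations X Y A B) :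
    |∑ x, ∑ y, ∑ a, ∑ b, G.coeff x y a b * P x y a b| ≤ 1 := by
  obtain ⟨d, ψ, E, F, hψ, hE, hE1, hF, hF1, hP⟩ := hP
  have hPre (x y a b) : P x y a b = (star ψ.ofLp ⬝ᵥ ((E x a ⊗ₖ F y b) *ᵥ ψ.ofLp)).re := by
    rw [← Complex.ofReal_re (P x y a b), hP, inner_toEuclideanCLM]
    rfl
  have hP0 (x y a b) : 0 ≤ P x y a b := by
    rw [hPre]
    exact ((hE x a).kronecker (hF y b)).re_dotProduct_nonneg _
  have hPsum (x y) : ∑ a, ∑ b, P x y a b ≤ 1 := by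
    simp only [hPre, ← Complex.re_sum, ← dotProduct_sum, ← Matrix.sum_mulVec]
    rw [sum_sum_kronecker_eq_one (hE1 x) (hF1 y), Matrix.one_mulVec, ← norm_sq_eq_re_dotProduct]
    exact pow_le_one₀ (norm_nonneg _) hψ
  rw [abs_of_nonneg (Finset.sum_nonneg fun x _ => Finset.sum_nonneg fun y _ =>
    Finset.sum_nonneg fun a _ => Finset.sum_nonneg fun b _ =>
      mul_nonneg (G.coeff_nonneg x y a b) (hP0 x y a b)), ← G.prob_sum]
  refine Finset.sum_le_sum fun x _ => Finset.sum_le_sum fun y _ => ?_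
  calc ∑ a, ∑ b, G.coeff x y a b * P x y a b
      ≤ ∑ a, ∑ b, G.prob x y * P x y a b :=
        Finset.sum_le_sum fun a _ => Finset.sum_le_sum fun b _ =>
          mul_le_mul_of_nonneg_right
            (mul_le_of_le_one_right (G.prob_nonneg x y) (G.payoff_le_one a b x y)) (hP0 x y a b)
    _ = G.prob x y * ∑ a, ∑ b, P x y a b := by simp only [Finset.mul_sum]
    _ ≤ G.prob x y := mul_le_of_le_one_right (G.prob_nonneg x y) (hPsum x y)

theorem Game.entangledValue_ne_top [Fintype A] [Fintype B] (G : Game X Y A B) :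
    G.entangledValue ≠ ⊤ := by
  refine ne_top_of_le_ne_top ENNReal.ofReal_ne_top (b := ENNReal.ofReal 1) ?_
  exact iSup₂_le fun P hP => ENNReal.ofReal_le_ofReal (G.abs_sum_le_one hP)

variable [Fintype A] [Fintype B]

/-- The diagonal forms of a pair of families of POVMs are bounded by the entangled value. -/
theorem Game.sum_re_form_le_entangledValue (G : Game X Y A B) {d : ℕ}
    {E : X → A → Matrix (Fin d) (Fin d) ℂ} {F : Y → B → Matrix (Fin d) (Fin d) ℂ}
    (hE : ∀ x a, (E x a).PosSemidef) (hE1 : ∀ x, ∑ a, E x a = 1)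
    (hF : ∀ y b, (F y b).PosSemidef) (hF1 : ∀ y, ∑ b, F y b = 1)
    {φ : Fin d × Fin d → ℂ} (hφ : (star φ ⬝ᵥ φ).re = 1) :
    ∑ x, ∑ y, ∑ a, ∑ b, G.coeff x y a b * (star φ ⬝ᵥ ((E x a ⊗ₖ F y b) *ᵥ φ)).re ≤
      G.entangledValue.toReal := by
  have hmem : (fun x y a b => (star φ ⬝ᵥ ((E x a ⊗ₖ F y b) *ᵥ φ)).re) ∈
      quantumCorrelations X Y A B := by
    refine ⟨d, WithLp.toLp 2 φ, E, F, ?_, hE, hE1, hF, hF1, fun x y a b => ?_⟩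
    · have h := norm_sq_eq_re_dotProduct (WithLp.toLp 2 φ)
      rw [hφ] at h
      nlinarith [norm_nonneg (WithLp.toLp 2 φ)]
    · rw [inner_toEuclideanCLM]
      apply Complex.ext
      · rfl
      · rw [Complex.ofReal_im]
        exact (((hE x a).kronecker (hF y b)).isHermitian.im_star_dotProduct_mulVec_self φ).symm
  refine (le_abs_self _).trans ?_
  rw [← ENNReal.ofReal_le_iff_le_toReal G.entangledValue_ne_top]
  exact le_iSup₂_of_le _ hmem le_rfl

variable [DecidableEq X] [DecidableEq Y] [DecidableEq A] [DecidableEq B]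

theorem Game.kroneckerMap_map_tensor (G : Game X Y A B) {d : ℕ}
    (T : (X × A → ℂ) →ₗ[ℂ] Matrix (Fin d) (Fin d) ℂ)
    (S : (Y × B → ℂ) →ₗ[ℂ] Matrix (Fin d) (Fin d) ℂ) :
    kroneckerMap d (TensorProduct.map T S G.tensor) = ∑ x, ∑ y, ∑ a, ∑ b,
      (G.coeff x y a b : ℂ) • (T (Pi.single (x, a) 1) ⊗ₖ S (Pi.single (y, b) 1)) := by
  simp only [Game.tensor, map_sum, map_smul, TensorProduct.map_tmul]
  rfl

theorem Game.form_kroneckerMap_map_tensor (G : Game X Y A B) {d : ℕ}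
    (T : (X × A → ℂ) →ₗ[ℂ] Matrix (Fin d) (Fin d) ℂ)
    (S : (Y × B → ℂ) →ₗ[ℂ] Matrix (Fin d) (Fin d) ℂ) (φ ψ : Fin d × Fin d → ℂ) :
    star φ ⬝ᵥ (kroneckerMap d (TensorProduct.map T S G.tensor) *ᵥ ψ) = ∑ x, ∑ y, ∑ a, ∑ b,
      (G.coeff x y a b : ℂ) *
        (star φ ⬝ᵥ ((T (Pi.single (x, a) 1) ⊗ₖ S (Pi.single (y, b) 1)) *ᵥ ψ)) := by
  simp only [G.kroneckerMap_map_tensor, Matrix.sum_mulVec, dotProduct_sum, Matrix.smul_mulVec,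
    dotProduct_smul, smul_eq_mul]

theorem Game.entangledValue_le_minNorm (G : Game X Y A B) :
    G.entangledValue ≤ minNorm (loneLinftyOSS X A) (loneLinftyOSS Y B) G.tensor := by
  refine iSup₂_le fun P hP => ?_
  obtain ⟨d, ψ, E, F, hψ, hE, hE1, hF, hF1, hP⟩ := hP
  let T := Fintype.linearCombination ℂ (fun z : X × A => E z.1 z.2)
  let S := Fintype.linearCombination ℂ (fun z : Y × B => F z.1 z.2)
  have hT (x a) : T (Pi.single (x, a) 1) = E x a := by
    simp [T, Fintype.linearCombination_apply_single]
  have hS (y b) : S (Pi.single (y, b) 1) = F y b := by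
    simp [S, Fintype.linearCombination_apply_single]
  have hTcb := cbNorm_le_one_of_povm (T := T) (by simpa only [hT] using hE)
    (by simpa only [hT] using hE1)
  have hScb := cbNorm_le_one_of_povm (T := S) (by simpa only [hS] using hF)
    (by simpa only [hS] using hF1)
  refine le_iSup_of_le d (le_iSup_of_le T (le_iSup_of_le S (le_iSup_of_le hTcb
    (le_iSup_of_le hScb ?_))))
  refine le_trans (le_of_eq ?_) (norm_inner_toEuclideanCLM_le _ ψ hψ)
  rw [inner_toEuclideanCLM, G.form_kroneckerMap_map_tensor]
  simp only [hT, hS, ← inner_toEuclideanCLM]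
  rw [← Real.norm_eq_abs, ← Complex.norm_real]
  push_cast
  simp only [hP]
  rfl

/-- Both complete contractions are off-diagonal blocks of positive matrices with POVMs on the diagonal,
and the coefficients of the game are nonnegative, so that the sesquilinear form of the matrix
`(T ⊗ S)(Ĝ)` at two unit vectors is at most the mean of two values of quantum strategies. -/
theorem Game.minNorm_le_entangledValue (G : Game X Y A B) :
    minNorm (loneLinftyOSS X A) (loneLinftyOSS Y B) G.tensor ≤ G.entangledValue := by
  refine iSup_le fun d => iSup_le fun T => iSup_le fun S => iSup_le fun hT => iSup_le fun hS => ?_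
  rw [← ENNReal.ofReal_toReal G.entangledValue_ne_top]
  refine opNorm_le_of_re_form_le ENNReal.toReal_nonneg fun φ ψ hφ hψ => ?_
  rw [G.form_kroneckerMap_map_tensor]
  -- Without answers of one of the players the tensor vanishes, and a POVM need not exist.
  obtain hA | hA := isEmpty_or_nonempty A
  · simp
  obtain hB | hB := isEmpty_or_nonempty B
  · simp
  choose E E' hE hE1 hE1' using fun x => exists_povm_fromBlocks_posSemidef
    (opNorm_sum_kronecker_le_one_of_cbNorm hT x)
  choose F F' hF hF1 hF1' using fun y => exists_povm_fromBlocks_posSemidef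
    (opNorm_sum_kronecker_le_one_of_cbNorm hS y)
  have h₁ := G.sum_re_form_le_entangledValue (E := E) (F := F)
    (fun x a => (hE x a).submatrix Sum.inl) hE1 (fun y b => (hF y b).submatrix Sum.inl) hF1 hφ
  have h₂ := G.sum_re_form_le_entangledValue (E := E') (F := F')
    (fun x a => (hE x a).submatrix Sum.inr) hE1' (fun y b => (hF y b).submatrix Sum.inr) hF1' hψ
  have h₃ : 2 * ∑ x, ∑ y, ∑ a, ∑ b, G.coeff x y a b *
        (star φ ⬝ᵥ ((T (Pi.single (x, a) 1) ⊗ₖ S (Pi.single (y, b) 1)) *ᵥ ψ)).re ≤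
      (∑ x, ∑ y, ∑ a, ∑ b, G.coeff x y a b * (star φ ⬝ᵥ ((E x a ⊗ₖ F y b) *ᵥ φ)).re) +
      ∑ x, ∑ y, ∑ a, ∑ b, G.coeff x y a b * (star ψ ⬝ᵥ ((E' x a ⊗ₖ F' y b) *ᵥ ψ)).re := by
    simp only [Finset.mul_sum, ← Finset.sum_add_distrib, ← mul_add]
    refine Finset.sum_le_sum fun x _ => Finset.sum_le_sum fun y _ => Finset.sum_le_sum fun a _ =>
      Finset.sum_le_sum fun b _ => ?_
    rw [mul_left_comm]
    exact mul_le_mul_of_nonneg_left (two_mul_re_form_kronecker_le (hE x a) (hF y b) φ ψ)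
      (G.coeff_nonneg x y a b)
  simp only [Complex.re_sum, Complex.re_ofReal_mul]
  linarith

end

end NonlocalGame

end

/-- The entangled value of a two-player game is finite and equals the minimal operator space
tensor norm of its tensor in `ℓ_1^X(ℓ_∞^A) ⊗_min ℓ_1^Y(ℓ_∞^B)`. -/
theorem mainTheorem1 {X Y A B : Type*} [Fintype X] [DecidableEq X] [Fintype Y] [DecidableEq Y]
    [Fintype A] [DecidableEq A] [Fintype B] [DecidableEq B]
    (G : NonlocalGame.Game X Y A B) :
    G.entangledValue ≠ ⊤ ∧
    G.entangledValue =
      NonlocalGame.minNorm (NonlocalGame.loneLinftyOSS X A) (NonlocalGame.loneLinftyOSS Y B)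
        G.tensor :=
  ⟨G.entangledValue_ne_top, le_antisymm G.entangledValue_le_minNorm G.minNorm_le_entangledValue⟩
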